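/- Let $F$ be a field with algebraic closure $K$, let $d,e\ge 2$ be integers such that $\operatorname{char}(F)$ does not divide $d$, and put $n=de$ and $q=d+e-1$. Notation. Let $P_d(K)$ be the set of monic polynomials in $K[X]$ of degree $d$ and $P_e^*(K)$ the set of monic polynomials in $K[X]$ of degree $e$ with constant coefficient $0$, identified with the affine spaces $K^d$ and $K^{e-1}$ through their non-leading coefficients (in degrees $0,\dots,d-1$ and $1,\dots,e-1$, respectively). Let $C_{n,d}(K)=\{g\circ h : g\in P_d(K),\ h\in P_e^*(K)\}$. Let $$\Gamma_{n,d}=\{(g,h,\alpha,\beta)\in P_d(K)\times P_e^*(K)\times K^{q}\times K^{q} : (g\circ h)(\alpha_i)=\beta_i \text{ for } 1\le i\le q\},$$ and let $\pi\colon\Gamma_{n,d}\to K^{q}\times K^{q}$ be the projection $(g,h,\alpha,\beta)\mapsto(\alpha,\beta)$. For a partition $\mathcal P$ of $\{1,\dots,q\}$ into $m$ blocks, consider the $r=q-m$ pairs $(i,j)$ where $i$ is the smallest element of a block of $\mathcal P$ and $j\neq i$ lies in the same block, in lexicographic order. Let $\Delta_{\mathcal P}\in F[A_1,\dots,A_{q}]$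 be the determinant of the $r\times r$ matrix whose row for $(i,j)$ is $(A_i-A_j,\,A_i^2-A_j^2,\,\dots,\,A_i^r-A_j^r)$. Define $$R^{(1)}=\prod_{\mathcal Q}\Delta_{\mathcal Q},\qquad R^{(2)}=R^{(1)}\cdot\prod_{\mathcal P}\Delta_{\mathcal P},$$ where $\mathcal Q$ runs over the partitions of $\{1,\dots,q\}$ into exactly $d-1$ blocks, and $\mathcal P$ over those into exactly $d$ blocks. Statement. (i) $\pi$ is dominant: its image is Zariski dense in $K^{q}\times K^{q}$. (ii) For all $\alpha,\beta\in K^{q}$ with $R^{(2)}(\alpha)\neq 0$, the fiber $\pi^{-1}(\alpha,\beta)$ has dimension zero (in particular, it is nonempty). (iii) Hence almost all interpolation instances have a finite, nonzero number of decomposable interpolants: the polynomial $R^{(2)}$ is nonzero, and for all $\alpha,\beta\in K^{q}$ with $R^{(2)}(\alpha)\neq 0$ the set $\{f\in C_{n,d}(K): f(\alpha_i)=\beta_i \text{ for } 1\le i\le q\}$ is finite and nonempty. -/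

import Mathlib

namespace DecompInterp

noncomputable section

open Polynomial

/-! ### The polynomial `R^(2)` -/

/-- The smallest element of the block of `P` that contains `j`. -/
def leader {q : ℕ} (P : Finpartition (Finset.univ : Finset (Fin q))) (j : Fin q) : Fin q :=
  (P.part j).min' ⟨j, P.mem_part (Finset.mem_univ j)⟩

/-- The pairs `(i, j)` where `i` is the smallest element of a block of `P` and `j` is another
element of the same block. The lexicographic order sorts the blocks by their smallest elements,
and then sorts the elements inside a block. -/
def pairs {q : ℕ} (P : Finpartition (Finset.univ : Finset (Fin q))) :
    Finset (Fin q ×ₗ Fin q) :=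
  (Finset.univ.filter fun j => leader P j ≠ j).map
    ⟨fun j => toLex (leader P j, j), fun _ _ h => congrArg (fun p => (ofLex p).2) h⟩

/-- The determinant of the square matrix that has one row
`(A_i - A_j, A_i ^ 2 - A_j ^ 2, …, A_i ^ r - A_j ^ r)` for each of the `r` pairs `(i, j)` in
`pairs P`. A partition of a `q`-element set into `m` blocks has `r = q - m`
(see `card_pairs`). -/
def blockDet (F : Type*) [CommRing F] {q : ℕ}
    (P : Finpartition (Finset.univ : Finset (Fin q))) : MvPolynomial (Fin q) F :=
  Matrix.det (Matrix.of fun (a k : Fin (pairs P).card) =>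
    let p := ofLex ((pairs P).orderEmbOfFin rfl a)
    (MvPolynomial.X p.1 ^ (k.val + 1) - MvPolynomial.X p.2 ^ (k.val + 1) :
      MvPolynomial (Fin q) F))

/-- The product of the determinants `blockDet` (of size `e`) over all partitions of the
`d + e - 1` indices into exactly `d - 1` blocks. -/
def R1 (F : Type*) [CommRing F] (d e : ℕ) : MvPolynomial (Fin (d + e - 1)) F :=
  ∏ P : Finpartition (Finset.univ : Finset (Fin (d + e - 1))) with P.parts.card = d - 1,
    blockDet F P

/-- `R1` times the product of the determinants `blockDet` (of size `e - 1`) over all partitions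
of the `d + e - 1` indices into exactly `d` blocks. -/
def R2 (F : Type*) [CommRing F] (d e : ℕ) : MvPolynomial (Fin (d + e - 1)) F :=
  R1 F d e *
    ∏ P : Finpartition (Finset.univ : Finset (Fin (d + e - 1))) with P.parts.card = d,
      blockDet F P

/-- The matrix in `blockDet` has `q - m` rows if `P` has `m` blocks. -/
theorem card_pairs {q : ℕ} (P : Finpartition (Finset.univ : Finset (Fin q))) :
    (pairs P).card + P.parts.card = q := by
  have hmem : ∀ j, leader P j ∈ P.part j := fun j => Finset.min'_mem _ _
  have hpart : ∀ j, P.part (leader P j) = P.part j := fun j =>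
    P.part_eq_of_mem (P.part_mem.2 (Finset.mem_univ j)) (hmem j)
  have hll : ∀ j, leader P (leader P j) = leader P j := fun j => by
    unfold leader
    congr 1
    exact hpart j
  have h1 : (Finset.univ.filter fun j => leader P j = j).card = P.parts.card := by
    refine Finset.card_bij (fun j _ => P.part j)
      (fun j _ => P.part_mem.2 (Finset.mem_univ j)) ?_ ?_
    · intro i hi j hj hij
      rw [← (Finset.mem_filter.1 hi).2, ← (Finset.mem_filter.1 hj).2]
      unfold leader
      congr 1
    · intro b hb
      obtain ⟨j, hj⟩ := P.nonempty_of_mem_parts hb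
      refine ⟨leader P j, by simp [hll], ?_⟩
      rw [hpart, P.part_eq_of_mem hb hj]
  have h2 := Finset.card_filter_add_card_filter_not (s := (Finset.univ : Finset (Fin q)))
    (fun j => leader P j = j)
  rw [pairs, Finset.card_map, ← h1]
  simp only [Finset.card_univ, Fintype.card_fin] at h2
  simp only [ne_eq]
  omega

/-! ### Decomposable polynomials and the incidence variety -/

variable (K : Type*) [Field K]

/-- The monic polynomials of degree `n`. -/
def monicPolys (n : ℕ) : Set K[X] := {f | f.Monic ∧ f.natDegree = n}

/-- The monic original polynomials of degree `n` (constant coefficient `0`). -/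
def originalPolys (n : ℕ) : Set K[X] := {f | f ∈ monicPolys K n ∧ f.coeff 0 = 0}

/-- The compositions `g ∘ h` with `g` monic of degree `d` and `h` monic original of degree `e`. -/
def decomposables (d e : ℕ) : Set K[X] :=
  {f | ∃ g ∈ monicPolys K d, ∃ h ∈ originalPolys K e, f = g.comp h}

/-- The decomposable interpolants of the data `(α, β)`. -/
def interpolants (d e : ℕ) (α β : Fin (d + e - 1) → K) : Set K[X] :=
  {f | f ∈ decomposables K d e ∧ ∀ i, f.eval (α i) = β i}

/-- The index set of the coordinates `G_0, …, G_{d-1}`, `H_1, …, H_{e-1}`, `A_i`, `B_i`. -/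
abbrev Coord (d e : ℕ) : Type :=
  (Fin d ⊕ Fin (e - 1)) ⊕ (Fin (d + e - 1) ⊕ Fin (d + e - 1))

variable {K}

/-- The affine coordinates of `(g, h, α, β)`, where a monic polynomial of degree `d` (a monic
original polynomial of degree `e`) is given by its coefficients in degrees `0, …, d - 1`
(in degrees `1, …, e - 1`). -/
def coordVec {d e : ℕ} (g h : K[X]) (α β : Fin (d + e - 1) → K) : Coord d e → K :=
  Sum.elim (Sum.elim (fun i => g.coeff i) (fun j => h.coeff (j + 1))) (Sum.elim α β)

variable (K)

/-- The incidence variety of all `(g, h, α, β)` with `(g ∘ h)(α_i) = β_i` for all `i`,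
in affine coordinates. -/
def incidence (d e : ℕ) : Set (Coord d e → K) :=
  {x | ∃ g ∈ monicPolys K d, ∃ h ∈ originalPolys K e, ∃ α β : Fin (d + e - 1) → K,
    (∀ i, (g.comp h).eval (α i) = β i) ∧ x = coordVec g h α β}

/-- The projection to the `(α, β)`-space. -/
def proj (d e : ℕ) (x : incidence K d e) : Fin (d + e - 1) ⊕ Fin (d + e - 1) → K :=
  fun i => x.1 (Sum.inr i)

/-- The fiber of the projection over `(α, β)`, as a subset of the ambient affine space. -/
def fiber (d e : ℕ) (α β : Fin (d + e - 1) → K) : Set (Coord d e → K) :=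
  Subtype.val '' (proj K d e ⁻¹' {Sum.elim α β})

variable {K}

/-- The Zariski closure of a subset of affine space. -/
def zariskiClosure {σ : Type*} (S : Set (σ → K)) : Set (σ → K) :=
  MvPolynomial.zeroLocus K (MvPolynomial.vanishingIdeal K S)

/-- A map to affine space is dominant if its image is Zariski dense. -/
def IsDominant {X σ : Type*} (φ : X → σ → K) : Prop :=
  zariskiClosure (Set.range φ) = Set.univ

/-- The dimension of an algebraic set, as the Krull dimension of its coordinate ring
(`⊥` for the empty set). -/
def dimension {σ : Type*} (V : Set (σ → K)) : WithBot ℕ∞ :=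
  ringKrullDim (MvPolynomial σ K ⧸ MvPolynomial.vanishingIdeal K V)

end

end DecompInterp

namespace DecompInterp

noncomputable section

/-! ### Finite maps between affine spaces -/

/-! Fix α with R2(α) ≠ 0. Sending the q = d + (e - 1) coefficients of (g, h) to the q values (g ∘
h)(α_i) is a polynomial map K^q → K^q. It is finite, hence surjective with finite fibers, which
yields all the claims.

Finiteness is checked on valuation rings V containing K and the generic values
(`isIntegral_adjoin_genericValue`). By `exists_card_eq_injOn_eval`, the determinants for m blocks
force a nonconstant polynomial of degree at most q - m over the residue field to take at least m + 1
values at the α_i. If h had a coefficient outside V, let c be one of largest valuation. Then h/c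
reduces to a nonconstant polynomial of degree at most e - 1, which separates d + 1 of the points. As
g(cX) has degree d and values in V at the corresponding values of h/c, Lagrange interpolation puts
its leading coefficient c^d in V, a contradiction. So h is over V, its reduction has degree e and
separates d points, and interpolating g - X^d there puts g over V. -/

/-- A valuative criterion for a polynomial map between affine spaces to be integral. -/
theorem isIntegral_adjoin_of_valuationSubring {σ τ K : Type*} [Field K]
    (φ : τ → MvPolynomial σ K)
    (hφ : ∀ (V : ValuationSubring (FractionRing (MvPolynomial σ K))),
      (∀ a : K, algebraMap K (FractionRing (MvPolynomial σ K)) a ∈ V) →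
      (∀ i, algebraMap (MvPolynomial σ K) (FractionRing (MvPolynomial σ K)) (φ i) ∈ V) →
      ∀ j, algebraMap (MvPolynomial σ K) (FractionRing (MvPolynomial σ K)) (MvPolynomial.X j) ∈ V) :
    Algebra.IsIntegral (Algebra.adjoin K (Set.range φ)) (MvPolynomial σ K) := by
  set L := FractionRing (MvPolynomial σ K)
  set A := Algebra.adjoin K (Set.range φ)
  have hinj : Function.Injective (algebraMap (MvPolynomial σ K) L) :=
    IsFractionRing.injective _ _
  have hX : ∀ j, IsIntegral A (MvPolynomial.X j : MvPolynomial σ K) := by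
    intro j
    rw [← isIntegral_algebraMap_iff (B := L) hinj]
    -- The integral closure of a subring of a field is the intersection of the valuation rings
    -- containing it.
    have hmem : algebraMap (MvPolynomial σ K) L (MvPolynomial.X j) ∈
        (integralClosure (Subring.closure ((algebraMap A L).range : Set L)) L).toSubring := by
      rw [← iInf_valuationSubring_superset, Subring.mem_iInf]
      rintro ⟨V, hV⟩
      refine hφ V (fun a => hV ⟨algebraMap K A a, ?_⟩) (fun i => hV ⟨⟨φ i, ?_⟩, rfl⟩) j
      · rw [← IsScalarTower.algebraMap_apply]
      · exact Algebra.subset_adjoin ⟨i, rfl⟩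
    rw [Subring.closure_eq] at hmem
    obtain ⟨p, hp, hpe⟩ : IsIntegral (algebraMap A L).range (algebraMap (MvPolynomial σ K) L (MvPolynomial.X j)) :=
      hmem
    obtain ⟨p', hp', -, hm⟩ := Polynomial.lifts_and_natDegree_eq_and_monic
      (Polynomial.mem_lifts_of_surjective (algebraMap A L).rangeRestrict_surjective p) hp
    refine ⟨p', hm, ?_⟩
    rw [← hp', Polynomial.eval₂_map] at hpe
    exact hpe
  refine ⟨fun p => ?_⟩
  induction p using MvPolynomial.induction_on with
  | C a => exact isIntegral_algebraMap (R := A) (x := algebraMap K A a)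
  | add p q hp hq => exact hp.add hq
  | mul_X p j hp => exact hp.mul (hX j)

/-- All points of a fiber induce the same homomorphism on the subalgebra, so each coordinate is a
root of one fixed monic polynomial over K. -/
theorem finite_setOf_eval_eq {σ τ K : Type*} [Finite σ] [Field K] (φ : τ → MvPolynomial σ K)
    [Algebra.IsIntegral (Algebra.adjoin K (Set.range φ)) (MvPolynomial σ K)] (β : τ → K) :
    {x : σ → K | ∀ i, MvPolynomial.eval x (φ i) = β i}.Finite := by
  set A := Algebra.adjoin K (Set.range φ)
  rcases Set.eq_empty_or_nonempty {x : σ → K | ∀ i, MvPolynomial.eval x (φ i) = β i} with h | h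
  · rw [h]; exact Set.finite_empty
  obtain ⟨x₀, hx₀⟩ := h
  choose p hp hpe using fun j =>
    Algebra.IsIntegral.isIntegral (R := A) (MvPolynomial.X j : MvPolynomial σ K)
  let ε (x : σ → K) : A →ₐ[K] K := (MvPolynomial.aeval x).comp A.val
  refine (Set.Finite.pi' (t := fun j => {z | ((p j).map (ε x₀).toRingHom).IsRoot z}) fun j =>
    Polynomial.finite_setOfPred_isRoot ((hp j).map _).ne_zero).subset fun x hx j => ?_
  have hε : ε x = ε x₀ := by
    refine AlgHom.adjoin_ext ?_
    rintro _ ⟨i, rfl⟩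
    exact (hx i).trans (hx₀ i).symm
  have := congrArg (MvPolynomial.aeval x : MvPolynomial σ K →ₐ[K] K).toRingHom (hpe j)
  rw [Polynomial.hom_eval₂, map_zero] at this
  rw [Set.mem_ofPred_eq, Polynomial.IsRoot, Polynomial.eval_map, ← hε]
  simp only [AlgHom.toRingHom_eq_coe, RingHom.coe_coe, MvPolynomial.aeval_X] at this
  exact this

/-- By transcendence degree, the φ i are algebraically independent, so every β defines a maximal
ideal of the subalgebra. Lying over and the Nullstellensatz lift it to a point. -/
theorem nonempty_setOf_eval_eq {σ τ K : Type*} [Fintype σ] [Fintype τ] [Field K] [IsAlgClosed K]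
    (hcard : Fintype.card τ = Fintype.card σ) (φ : τ → MvPolynomial σ K)
    [Algebra.IsIntegral (Algebra.adjoin K (Set.range φ)) (MvPolynomial σ K)] (β : τ → K) :
    {x : σ → K | ∀ i, MvPolynomial.eval x (φ i) = β i}.Nonempty := by
  have hind : AlgebraicIndependent K φ := by
    refine (Algebra.IsAlgebraic.isTranscendenceBasis_of_lift_le_trdeg_of_finite K φ ?_).1
    rw [MvPolynomial.trdeg_of_isDomain]
    simp [hcard]
  set A := Algebra.adjoin K (Set.range φ)
  let ε : A →ₐ[K] K := (MvPolynomial.aeval β).comp hind.aevalEquiv.symm.toAlgHom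
  have hε : Function.Surjective ε := fun a => ⟨algebraMap K A a, by simp⟩
  have hmax : (RingHom.ker ε).IsMaximal := RingHom.ker_isMaximal_of_surjective ε hε
  obtain ⟨P, -, hP, hPc⟩ := Ideal.exists_ideal_over_prime_of_isIntegral (S := MvPolynomial σ K)
    (RingHom.ker ε) ⊥ (by
      rw [← RingHom.ker_eq_comap_bot, (RingHom.injective_iff_ker_eq_bot _).1
        (FaithfulSMul.algebraMap_injective A (MvPolynomial σ K))]
      exact bot_le)
  have hPm : P.IsMaximal := Ideal.isMaximal_of_isIntegral_of_isMaximal_comap (R := A) P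
    (by rw [hPc]; exact hmax)
  obtain ⟨x, hx⟩ := MvPolynomial.isMaximal_iff_eq_vanishingIdeal_singleton.1 hPm
  refine ⟨x, fun i => ?_⟩
  let a : A := ⟨φ i, Algebra.subset_adjoin ⟨i, rfl⟩⟩
  have ha : ε a = β i := by
    have : hind.aevalEquiv (MvPolynomial.X i) = a := Subtype.ext (by simp [a])
    simp [ε, ← this]
  have hk : a - algebraMap K A (β i) ∈ RingHom.ker ε := by
    rw [RingHom.mem_ker, map_sub, ha, AlgHom.commutes]; simp
  rw [← hPc, Ideal.mem_comap, hx, MvPolynomial.mem_vanishingIdeal_singleton_iff] at hk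
  have : algebraMap A (MvPolynomial σ K) (a - algebraMap K A (β i)) =
    φ i - MvPolynomial.C (β i) := rfl
  rw [this] at hk
  simpa [sub_eq_zero, MvPolynomial.aeval_eq_eval] using hk

/-- The vanishing ideal of a finite nonempty set of points has a zero-dimensional quotient. -/
theorem dimension_eq_zero_of_finite {σ K : Type*} [Field K] {S : Set (σ → K)} (hf : S.Finite)
    (hn : S.Nonempty) : dimension S = 0 := by
  obtain ⟨x₀, hx₀⟩ := hn
  have hle : MvPolynomial.vanishingIdeal K S ≤ MvPolynomial.vanishingIdeal K {x₀} :=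
    MvPolynomial.vanishingIdeal_anti_mono (by simpa using hx₀)
  have hne : MvPolynomial.vanishingIdeal K S ≠ ⊤ := fun h =>
    (inferInstance : (MvPolynomial.vanishingIdeal K {x₀}).IsMaximal).ne_top (top_le_iff.1 (h ▸ hle))
  have : Nontrivial (MvPolynomial σ K ⧸ MvPolynomial.vanishingIdeal K S) :=
    Ideal.Quotient.nontrivial_iff.2 hne
  rw [dimension, ← ringKrullDimZero_iff_ringKrullDim_eq_zero, Ring.krullDimLE_zero_iff]
  intro J hJ
  have hcJ : (J.comap (Ideal.Quotient.mk (MvPolynomial.vanishingIdeal K S))).IsPrime :=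
    Ideal.comap_isPrime _ _
  -- A prime containing a finite intersection of maximal ideals contains one of them, hence equals
  -- it.
  have hinf : hf.toFinset.inf (fun x => MvPolynomial.vanishingIdeal K {x}) ≤
      J.comap (Ideal.Quotient.mk (MvPolynomial.vanishingIdeal K S)) := by
    intro p hp
    have : p ∈ MvPolynomial.vanishingIdeal K S := fun x hx =>
      (MvPolynomial.mem_vanishingIdeal_singleton_iff x p).1
        (Finset.inf_le (f := fun x => MvPolynomial.vanishingIdeal K {x})
          (hf.mem_toFinset.2 hx) hp)
    rw [Ideal.mem_comap, Ideal.Quotient.eq_zero_iff_mem.2 this]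
    exact J.zero_mem
  obtain ⟨x, -, hx⟩ := (Ideal.IsPrime.inf_le' hcJ).1 hinf
  have hm : (J.comap (Ideal.Quotient.mk (MvPolynomial.vanishingIdeal K S))).IsMaximal := by
    rw [← Ideal.IsMaximal.eq_of_le inferInstance hcJ.ne_top hx]
    infer_instance
  exact Ideal.isMaximal_of_isIntegral_of_isMaximal_comap' _
    (RingHom.isIntegral_of_surjective _ Ideal.Quotient.mk_surjective) J hm

open Polynomial

/-! ### The determinants `blockDet` -/

theorem leader_mem_part {q : ℕ} (P : Finpartition (Finset.univ : Finset (Fin q))) (j : Fin q) :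
    leader P j ∈ P.part j := Finset.min'_mem _ _

theorem part_leader {q : ℕ} (P : Finpartition (Finset.univ : Finset (Fin q))) (j : Fin q) :
    P.part (leader P j) = P.part j :=
  P.part_eq_of_mem (P.part_mem.2 (Finset.mem_univ j)) (leader_mem_part P j)

theorem leader_leader {q : ℕ} (P : Finpartition (Finset.univ : Finset (Fin q))) (j : Fin q) :
    leader P (leader P j) = leader P j := by
  unfold leader
  congr 1
  exact part_leader P j

theorem ofLex_mem_pairs {q : ℕ} {P : Finpartition (Finset.univ : Finset (Fin q))}
    {p : Fin q ×ₗ Fin q} (hp : p ∈ pairs P) :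
    (ofLex p).1 = leader P (ofLex p).2 ∧ leader P (ofLex p).2 ≠ (ofLex p).2 := by
  obtain ⟨j, hj, rfl⟩ := Finset.mem_map.1 hp
  exact ⟨rfl, (Finset.mem_filter.1 hj).2⟩

theorem map_blockDet {F κ : Type*} [CommRing F] [CommRing κ] {q : ℕ}
    (P : Finpartition (Finset.univ : Finset (Fin q))) (ψ : MvPolynomial (Fin q) F →+* κ) :
    ψ (blockDet F P) = Matrix.det (Matrix.of fun (a k : Fin (pairs P).card) =>
      ψ (MvPolynomial.X (ofLex ((pairs P).orderEmbOfFin rfl a)).1) ^ (k.val + 1) -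
      ψ (MvPolynomial.X (ofLex ((pairs P).orderEmbOfFin rfl a)).2) ^ (k.val + 1)) := by
  rw [blockDet, RingHom.map_det]
  congr 1
  ext a k
  simp

/-- Setting every leader to 0 leaves a Vandermonde matrix in the distinct variables A_j, with rows
scaled by -A_j. -/
theorem blockDet_ne_zero (F : Type*) [CommRing F] [IsDomain F] {q : ℕ}
    (P : Finpartition (Finset.univ : Finset (Fin q))) : blockDet F P ≠ 0 := by
  classical
  let ψ : MvPolynomial (Fin q) F →ₐ[F] MvPolynomial (Fin q) F :=
    MvPolynomial.aeval fun j => if leader P j = j then 0 else MvPolynomial.X j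
  intro h
  have h0 : ψ.toRingHom (blockDet F P) = 0 := by rw [h, map_zero]
  rw [map_blockDet] at h0
  let x (a : Fin (pairs P).card) : MvPolynomial (Fin q) F :=
    MvPolynomial.X (ofLex ((pairs P).orderEmbOfFin rfl a)).2
  have hmem (a : Fin (pairs P).card) :=
    ofLex_mem_pairs (Finset.orderEmbOfFin_mem (pairs P) rfl a)
  have hx : Function.Injective x := by
    intro a b hab
    have h2 := MvPolynomial.X_injective hab
    refine ((pairs P).orderEmbOfFin rfl).injective (ofLex.injective (Prod.ext ?_ h2))
    rw [(hmem a).1, (hmem b).1, h2]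
  have : (Matrix.of fun (a k : Fin (pairs P).card) =>
      ψ.toRingHom (MvPolynomial.X (ofLex ((pairs P).orderEmbOfFin rfl a)).1) ^ (k.val + 1) -
      ψ.toRingHom (MvPolynomial.X (ofLex ((pairs P).orderEmbOfFin rfl a)).2) ^ (k.val + 1)) =
      Matrix.of fun a k => (-x a) * Matrix.vandermonde x a k := by
    ext1 a k
    have h1 : ψ (MvPolynomial.X (ofLex ((pairs P).orderEmbOfFin rfl a)).1) = 0 := by
      rw [(hmem a).1]
      simp [ψ, leader_leader]
    have h2 : ψ (MvPolynomial.X (ofLex ((pairs P).orderEmbOfFin rfl a)).2) = x a := by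
      simp [ψ, (hmem a).2, x]
    simp [h1, h2, Matrix.vandermonde_apply, pow_succ']
  rw [this, Matrix.det_mul_column, mul_eq_zero, Finset.prod_eq_zero_iff] at h0
  rcases h0 with ⟨a, -, ha⟩ | h0
  · exact MvPolynomial.X_ne_zero _ (neg_eq_zero.1 ha)
  · exact Matrix.det_vandermonde_ne_zero_iff.2 hx h0

/-- A polynomial of degree at most the size of `blockDet` that is constant along the blocks at a
point where `blockDet` does not vanish is constant. -/
theorem natDegree_eq_zero_of_blockDet {F κ : Type*} [CommRing F] [Field κ] {q : ℕ}
    {P : Finpartition (Finset.univ : Finset (Fin q))} {ψ : MvPolynomial (Fin q) F →+* κ}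
    (hψ : ψ (blockDet F P) ≠ 0) {h : κ[X]} (hdeg : h.natDegree ≤ (pairs P).card)
    (hc : ∀ i j, P.part i = P.part j →
      h.eval (ψ (MvPolynomial.X i)) = h.eval (ψ (MvPolynomial.X j))) : h.natDegree = 0 := by
  rw [map_blockDet] at hψ
  -- The constant term cancels in differences of values, so the other coefficients form a kernel
  -- vector.
  have h0 := Matrix.eq_zero_of_mulVec_eq_zero hψ
    (v := fun k : Fin (pairs P).card => h.coeff (k + 1)) (by
      ext a
      have hmem := ofLex_mem_pairs (Finset.orderEmbOfFin_mem (pairs P) rfl a)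
      have := hc (ofLex ((pairs P).orderEmbOfFin rfl a)).1
        (ofLex ((pairs P).orderEmbOfFin rfl a)).2 (by rw [hmem.1, part_leader])
      rw [eval_eq_sum_range' (Nat.lt_succ_of_le hdeg), eval_eq_sum_range' (Nat.lt_succ_of_le hdeg),
        Finset.sum_range_succ', Finset.sum_range_succ', pow_zero, pow_zero, add_left_inj,
        ← sub_eq_zero, ← Finset.sum_sub_distrib, Finset.sum_range] at this
      simp only [Matrix.mulVec, dotProduct, Matrix.of_apply, Pi.zero_apply]
      rw [← this]
      exact Finset.sum_congr rfl fun k _ => by ring)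
  by_contra hne
  have hlt : h.natDegree - 1 < (pairs P).card := by omega
  have := congrFun h0 ⟨h.natDegree - 1, hlt⟩
  simp only [Pi.zero_apply] at this
  rw [Nat.sub_add_cancel (by omega), coeff_natDegree, leadingCoeff_eq_zero] at this
  simp [this] at hne

theorem exists_finset_image_eq_injOn {α κ : Type*} [Fintype α] [DecidableEq κ] (f : α → κ) :
    ∃ T : Finset α, T.image f = Finset.univ.image f ∧ Set.InjOn f T := by
  classical
  obtain ⟨u, hu, hi⟩ := Set.exists_image_eq_and_injOn Set.univ f
  refine ⟨u.toFinite.toFinset, ?_, by simpa using hi⟩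
  rw [← Finset.coe_inj]
  simpa using hu

/-- A function with at most `m` values is constant on the blocks of a partition into exactly `m`
blocks. -/
theorem exists_finpartition_card_eq {q m : ℕ} (hm : m ≤ q) {κ : Type*} [DecidableEq κ]
    (f : Fin q → κ) (hf : (Finset.univ.image f).card ≤ m) :
    ∃ P : Finpartition (Finset.univ : Finset (Fin q)), P.parts.card = m ∧
      ∀ i j, P.part i = P.part j → f i = f j := by
  classical
  obtain ⟨T, hTi, hT⟩ := exists_finset_image_eq_injOn f
  have hTc : T.card ≤ m := by rwa [← Finset.card_image_of_injOn hT, hTi]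
  -- Enlarging the transversal T to m elements and retracting onto it by `g` refines the fibers of
  -- `f` to exactly m blocks.
  obtain ⟨S, hTS, -, hS⟩ := Finset.exists_subsuperset_card_eq (Finset.subset_univ T) hTc
    (by simpa using hm)
  have hex : ∀ i, ∃ t ∈ T, f t = f i := fun i => by
    have : f i ∈ T.image f := hTi ▸ Finset.mem_image_of_mem f (Finset.mem_univ i)
    simpa using this
  choose t htT hft using hex
  let g (i : Fin q) : Fin q := if i ∈ S then i else t i
  have hfg : ∀ i, f (g i) = f i := fun i => by
    by_cases hi : i ∈ S <;> simp [g, hi, hft]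
  have hgS : ∀ i, g i ∈ S := fun i => by
    by_cases hi : i ∈ S <;> simp [g, hi]
    exact hTS (htT i)
  have hgg : ∀ i ∈ S, g i = i := fun i hi => by simp [g, hi]
  let P := Finpartition.ofSetoid (Setoid.ker g)
  have hP : ∀ i j, P.part i = P.part j ↔ g i = g j := fun i j => by
    rw [← P.mem_part_iff_part_eq_part (Finset.mem_univ i) (Finset.mem_univ j),
      Finpartition.mem_part_ofSetoid_iff_rel, Setoid.ker_def, eq_comm]
  refine ⟨P, ?_, fun i j hij => by rw [← hfg i, ← hfg j, (hP i j).1 hij]⟩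
  rw [← hS]
  symm
  refine Finset.card_bij (fun i _ => P.part i) (fun i _ => P.part_mem.2 (Finset.mem_univ i)) ?_ ?_
  · intro i hi j hj hij
    rw [← hgg i hi, ← hgg j hj, (hP i j).1 hij]
  · intro b hb
    obtain ⟨j, hj⟩ := P.nonempty_of_mem_parts hb
    refine ⟨g j, hgS j, ?_⟩
    rw [← P.part_eq_of_mem hb hj, hP, hgg _ (hgS j)]

/-- With at most m values, `h` would be constant on the blocks of some m-block partition, whose
determinant has size q - m ≥ deg h; then `h` would be constant. -/
theorem exists_card_eq_injOn_eval {F κ : Type*} [CommRing F] [Field κ] {q m : ℕ} (hm : m ≤ q)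
    {ψ : MvPolynomial (Fin q) F →+* κ}
    (hψ : ∀ P : Finpartition (Finset.univ : Finset (Fin q)), P.parts.card = m →
      ψ (blockDet F P) ≠ 0)
    {h : κ[X]} (hdeg : h.natDegree + m ≤ q) (h0 : h.natDegree ≠ 0) :
    ∃ s : Finset (Fin q), s.card = m + 1 ∧
      Set.InjOn (fun i => h.eval (ψ (MvPolynomial.X i))) s := by
  classical
  have hlt : m < (Finset.univ.image fun i => h.eval (ψ (MvPolynomial.X i))).card := by
    by_contra hle
    obtain ⟨P, hPm, hP⟩ := exists_finpartition_card_eq hm _ (not_lt.1 hle)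
    have := card_pairs P
    exact h0 (natDegree_eq_zero_of_blockDet (hψ P hPm) (by omega) hP)
  obtain ⟨T, hTi, hT⟩ := exists_finset_image_eq_injOn
    fun i => h.eval (ψ (MvPolynomial.X i))
  rw [← hTi, Finset.card_image_of_injOn hT] at hlt
  obtain ⟨s, hsT, hs⟩ := Finset.exists_subset_card_eq (s := T) (n := m + 1) hlt
  exact ⟨s, hs, hT.mono hsT⟩

/-! ### Bounds for the coefficients of a composition over a valuation ring -/

/-- A polynomial that takes values in a valuation ring at more points than its degree, where the
points are distinct modulo the maximal ideal, has coefficients in the valuation ring. -/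
theorem coeff_mem_of_eval_mem {L ι : Type*} [Field L] {V : ValuationSubring L} {s : Finset ι}
    {y : ι → V} (hy : Set.InjOn (fun i => IsLocalRing.residue V (y i)) s) {P : L[X]}
    (hdeg : P.degree < s.card) (hP : ∀ i ∈ s, P.eval (y i : L) ∈ V) (k : ℕ) : P.coeff k ∈ V := by
  classical
  have hinj : Set.InjOn (fun i => (y i : L)) s := fun i hi j hj hij =>
    hy hi hj (congrArg _ (Subtype.ext hij))
  have hmem : P ∈ liftsRing V.subtype := by
    rw [Lagrange.eq_interpolate hinj hdeg, Lagrange.interpolate_apply]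
    refine Subring.sum_mem _ fun i hi => Subring.mul_mem _ ?_ (Subring.prod_mem _ fun j hj => ?_)
    · exact (lifts_iff_liftsRing _ _).1 (C_mem_lifts V.subtype ⟨_, hP i hi⟩)
    · rw [Finset.mem_erase] at hj
      refine Subring.mul_mem _ ?_ (Subring.sub_mem _ ?_ ?_)
      -- Distinct residues make the Lagrange denominators units.
      · have hu : IsUnit (y i - y j) := by
          rw [← IsLocalRing.residue_ne_zero_iff_isUnit, map_sub, sub_ne_zero]
          exact fun h => hj.1 (hy hj.2 hi h.symm)
        obtain ⟨u, hu⟩ := hu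
        have : ((y i : L) - y j)⁻¹ = V.subtype (↑u⁻¹ : V) := by
          refine inv_eq_of_mul_eq_one_right ?_
          have h1 : (y i : L) - y j = V.subtype (u : V) := by rw [hu]; rfl
          rw [h1, ← map_mul, Units.mul_inv, map_one]
        rw [this]
        exact (lifts_iff_liftsRing _ _).1 (C_mem_lifts _ _)
      · exact (lifts_iff_liftsRing _ _).1 (X_mem_lifts _)
      · exact (lifts_iff_liftsRing _ _).1 (C_mem_lifts V.subtype (y j))
  rw [← lifts_iff_liftsRing, lifts_iff_coeff_lifts] at hmem
  obtain ⟨z, hz⟩ := hmem k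
  rw [← hz]
  exact z.2

theorem exists_map_subtype_eq {L : Type*} [Field L] {V : ValuationSubring L} {P : L[X]}
    (h : ∀ k, P.coeff k ∈ V) : ∃ Q : V[X], Q.map V.subtype = P :=
  (mem_lifts _).1 ((lifts_iff_coeff_lifts P).2 fun k => ⟨⟨_, h k⟩, rfl⟩)

section

variable {F L : Type*} [CommRing F] [Field L] {V : ValuationSubring L} {d e : ℕ}
  {θ : MvPolynomial (Fin (d + e - 1)) F →+* V} {g h : L[X]}

/-- The inner polynomial of a composition with bounded values is bounded. -/
theorem coeff_mem_of_comp_eval_mem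
    (hθ : ∀ P : Finpartition (Finset.univ : Finset (Fin (d + e - 1))), P.parts.card = d →
      IsLocalRing.residue V (θ (blockDet F P)) ≠ 0)
    (hd : d ≠ 0) (hg : g.Monic) (hgd : g.natDegree = d) (hh : h.Monic) (hhe : h.natDegree = e)
    (hh0 : h.coeff 0 = 0) (hval : ∀ i, (g.comp h).eval (θ (MvPolynomial.X i) : L) ∈ V) (k : ℕ) :
    h.coeff k ∈ V := by
  by_contra hk
  obtain ⟨m, hm, hmax⟩ := h.support.exists_max_image (fun j => V.valuation (h.coeff j))
    ⟨k, mem_support_iff.2 fun h0 => hk (h0 ▸ V.zero_mem)⟩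
  set c := h.coeff m with hc
  have hc0 : c ≠ 0 := mem_support_iff.1 hm
  have hle : ∀ j, V.valuation (h.coeff j) ≤ V.valuation c := fun j => by
    by_cases hj : h.coeff j = 0
    · rw [hj, map_zero]; exact zero_le
    · exact hmax j (mem_support_iff.2 hj)
  have hc1 : 1 < V.valuation c := by
    refine lt_of_lt_of_le ?_ (hle k)
    rw [← not_le, V.valuation_le_one_iff]
    exact hk
  obtain ⟨Q, hQ⟩ := exists_map_subtype_eq (V := V) (P := C c⁻¹ * h) fun j => by
    rw [coeff_C_mul, ← V.valuation_le_one_iff, map_mul, map_inv₀]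
    exact (inv_mul_le_one₀ (zero_lt_one.trans hc1)).2 (hle j)
  have hQc (j : ℕ) : (Q.coeff j : L) = c⁻¹ * h.coeff j := by
    rw [← coeff_C_mul, ← hQ, coeff_map]; rfl
  set r := IsLocalRing.residue V
  -- The leading coefficient of h/c is c⁻¹, which reduces to 0.
  have hdeg : (Q.map r).natDegree ≤ e - 1 := by
    refine natDegree_le_iff_coeff_eq_zero.2 fun j hj => ?_
    rw [coeff_map, IsLocalRing.residue_eq_zero_iff, V.valuation_lt_one_iff, hQc]
    rcases (show e ≤ j by omega).eq_or_lt with rfl | hj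
    · rw [← hhe, coeff_natDegree, hh.leadingCoeff, mul_one, map_inv₀]
      exact inv_lt_one_of_one_lt₀ hc1
    · rw [coeff_eq_zero_of_natDegree_lt (hhe.trans_lt hj)]
      simp
  have hne : (Q.map r).natDegree ≠ 0 := by
    have h1 : (Q.map r).coeff m = 1 := by
      have : Q.coeff m = 1 := Subtype.ext (by rw [hQc, ← hc, inv_mul_cancel₀ hc0]; rfl)
      rw [coeff_map, this, map_one]
    -- This is where the vanishing constant coefficient of h enters: the coefficient reducing to 1
    -- has positive degree.
    have hm0 : m ≠ 0 := fun h0 => hc0 (by rw [hc, h0, hh0])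
    have := le_natDegree_of_ne_zero (h1 ▸ one_ne_zero)
    omega
  obtain ⟨s, hs, hinj⟩ := exists_card_eq_injOn_eval (ψ := r.comp θ) (by omega) hθ
    (h := Q.map r) (by omega) hne
  have key := coeff_mem_of_eval_mem (s := s) (y := fun i => Q.eval (θ (MvPolynomial.X i)))
    (P := g.comp (C c * X)) (by
      intro i hi j hj hij
      refine hinj hi hj ?_
      simpa [eval_map, eval₂_at_apply] using hij) (by
      refine lt_of_le_of_lt degree_le_natDegree ?_
      rw [natDegree_comp, natDegree_C_mul_X c hc0, hgd, hs]
      exact_mod_cast (by omega)) (fun i _ => by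
      have h1 : ((Q.eval (θ (MvPolynomial.X i)) : V) : L) =
          c⁻¹ * h.eval (θ (MvPolynomial.X i) : L) := by
        rw [← eval_C_mul, ← hQ, eval_map]
        exact (eval₂_at_apply V.subtype _).symm
      have := hval i
      rw [eval_comp] at this ⊢
      rwa [h1, eval_mul, eval_C, eval_X, mul_inv_cancel_left₀ hc0]) d
  rw [comp_C_mul_X_coeff, ← hgd, coeff_natDegree, hg.leadingCoeff, one_mul,
    ← V.valuation_le_one_iff, map_pow, hgd] at key
  exact (one_lt_pow₀ hc1 hd).not_ge key

/-- The outer polynomial of a composition with bounded values is bounded if the inner one is. -/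
theorem coeff_mem_of_comp_eval_mem_of_coeff_mem (he : e ≠ 0) (hd : d ≠ 0)
    (hθ : ∀ P : Finpartition (Finset.univ : Finset (Fin (d + e - 1))), P.parts.card = d - 1 →
      IsLocalRing.residue V (θ (blockDet F P)) ≠ 0)
    (hg : g.Monic) (hgd : g.natDegree = d) (hh : h.Monic) (hhe : h.natDegree = e)
    (hval : ∀ i, (g.comp h).eval (θ (MvPolynomial.X i) : L) ∈ V) (hmem : ∀ k, h.coeff k ∈ V)
    (k : ℕ) : g.coeff k ∈ V := by
  obtain ⟨Q, hQ⟩ := exists_map_subtype_eq hmem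
  set r := IsLocalRing.residue V
  have hQm : Q.Monic := monic_of_injective V.subtype_injective (hQ ▸ hh)
  have hdeg : (Q.map r).natDegree = e := by
    rw [hQm.natDegree_map, ← hhe, ← hQ, hQm.natDegree_map]
  obtain ⟨s, hs, hinj⟩ := exists_card_eq_injOn_eval (ψ := r.comp θ) (by omega) hθ
    (h := Q.map r) (by omega) (hdeg ▸ he)
  have hQe (i) : ((Q.eval (θ (MvPolynomial.X i)) : V) : L) = h.eval (θ (MvPolynomial.X i) : L) := by
    rw [← hQ, eval_map]
    exact (eval₂_at_apply V.subtype _).symm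
  -- Removing X^d lowers the degree below d, so the d separated points suffice.
  have key := coeff_mem_of_eval_mem (s := s) (y := fun i => Q.eval (θ (MvPolynomial.X i)))
    (P := g - X ^ d) (by
      intro i hi j hj hij
      refine hinj hi hj ?_
      simpa [eval_map, eval₂_at_apply] using hij) (by
      rw [hs, Nat.sub_add_cancel (by omega), ← hgd, ← degree_eq_natDegree hg.ne_zero]
      refine degree_sub_lt_left ?_ hg.ne_zero ?_
      · rw [degree_X_pow, degree_eq_natDegree hg.ne_zero]
      · rw [hg.leadingCoeff, leadingCoeff_X_pow]) (fun i _ => by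
      have := hval i
      rw [eval_comp, ← hQe] at this
      rw [eval_sub, eval_pow, eval_X]
      exact sub_mem this (pow_mem (SetLike.coe_mem _) d)) k
  rw [coeff_sub, coeff_X_pow] at key
  have : g.coeff k = (g.coeff k - if k = d then 1 else 0) + if k = d then 1 else 0 := by ring
  rw [this]
  refine V.add_mem _ _ key ?_
  split_ifs
  exacts [V.one_mem, V.zero_mem]

end

/-! ### The fibers of the projection -/

/-! ### Monic polynomials with prescribed coefficients -/

section

variable {R : Type*} [CommRing R] {d e : ℕ}

/-- The monic polynomial of degree `d` with the given non-leading coefficients. -/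
def outerPoly (x : Fin d ⊕ Fin (e - 1) → R) : R[X] :=
  X ^ d + ∑ i : Fin d, C (x (Sum.inl i)) * X ^ (i : ℕ)

/-- The monic polynomial of degree `e` with constant coefficient `0` and the given coefficients
in degrees `1, …, e - 1`. -/
def innerPoly (x : Fin d ⊕ Fin (e - 1) → R) : R[X] :=
  X ^ e + ∑ j : Fin (e - 1), C (x (Sum.inr j)) * X ^ ((j : ℕ) + 1)

variable (x : Fin d ⊕ Fin (e - 1) → R)

theorem coeff_outerPoly (i : Fin d) : (outerPoly x).coeff i = x (Sum.inl i) := by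
  rw [outerPoly, coeff_add, coeff_X_pow, if_neg i.2.ne, zero_add, finsetSum_coeff,
    Finset.sum_eq_single i]
  · simp
  · intro j _ hj
    rw [coeff_C_mul_X_pow, if_neg (fun h => hj (Fin.ext h.symm))]
  · simp

theorem coeff_innerPoly (he : 2 ≤ e) (j : Fin (e - 1)) :
    (innerPoly x).coeff (j + 1) = x (Sum.inr j) := by
  rw [innerPoly, coeff_add, coeff_X_pow, if_neg (by omega), zero_add, finsetSum_coeff,
    Finset.sum_eq_single j]
  · simp
  · intro i _ hi
    rw [coeff_C_mul_X_pow, if_neg (fun h => hi (Fin.ext (by omega)))]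
  · simp

theorem coeff_zero_innerPoly (he : 2 ≤ e) : (innerPoly x).coeff 0 = 0 := by
  rw [innerPoly, coeff_add, coeff_X_pow, if_neg (by omega), zero_add, finsetSum_coeff]
  exact Finset.sum_eq_zero fun j _ => by rw [coeff_C_mul_X_pow, if_neg (by omega)]

theorem degree_sum_outer_lt : (∑ i : Fin d, C (x (Sum.inl i)) * X ^ (i : ℕ)).degree < (d : WithBot ℕ) :=
  degree_sum_fin_lt _

theorem degree_sum_inner_lt (he : 2 ≤ e) :
    (∑ j : Fin (e - 1), C (x (Sum.inr j)) * X ^ ((j : ℕ) + 1)).degree < (e : WithBot ℕ) := by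
  refine (degree_sum_le _ _).trans_lt ((Finset.sup_lt_iff (WithBot.bot_lt_coe e)).2 fun j _ => ?_)
  refine (degree_C_mul_X_pow_le _ _).trans_lt (Nat.cast_lt.2 ?_)
  have := j.2
  omega

theorem monic_outerPoly : (outerPoly x).Monic := monic_X_pow_add (degree_sum_outer_lt x)

theorem monic_innerPoly (he : 2 ≤ e) : (innerPoly x).Monic :=
  monic_X_pow_add (degree_sum_inner_lt x he)

theorem natDegree_outerPoly [Nontrivial R] : (outerPoly x).natDegree = d := by
  refine natDegree_eq_of_degree_eq_some ?_
  rw [outerPoly, degree_add_eq_left_of_degree_lt, degree_X_pow]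
  rw [degree_X_pow]
  exact degree_sum_outer_lt x

theorem natDegree_innerPoly [Nontrivial R] (he : 2 ≤ e) : (innerPoly x).natDegree = e := by
  refine natDegree_eq_of_degree_eq_some ?_
  rw [innerPoly, degree_add_eq_left_of_degree_lt, degree_X_pow]
  rw [degree_X_pow]
  exact degree_sum_inner_lt x he

theorem map_outerPoly {S : Type*} [CommRing S] (f : R →+* S) :
    (outerPoly x).map f = outerPoly fun i => f (x i) := by
  simp [outerPoly, Polynomial.map_sum]

theorem map_innerPoly {S : Type*} [CommRing S] (f : R →+* S) :
    (innerPoly x).map f = innerPoly fun i => f (x i) := by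
  simp [innerPoly, Polynomial.map_sum]

/-- Serves both to specialize the generic coefficients at a point and to embed them in the fraction
field. -/
theorem map_eval_comp {S : Type*} [CommRing S] (f : R →+* S) (a : R) :
    f (((outerPoly x).comp (innerPoly x)).eval a) =
      ((outerPoly fun i => f (x i)).comp (innerPoly fun i => f (x i))).eval (f a) := by
  rw [← map_outerPoly, ← map_innerPoly, ← Polynomial.map_comp, eval_map, eval₂_at_apply]

end

/-! ### Fibers and interpolants as images of one solution set -/

section

variable {K : Type*} [Field K] {d e : ℕ}

theorem outerPoly_mem (x : Fin d ⊕ Fin (e - 1) → K) : outerPoly x ∈ monicPolys K d :=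
  ⟨monic_outerPoly x, natDegree_outerPoly x⟩

theorem innerPoly_mem (he : 2 ≤ e) (x : Fin d ⊕ Fin (e - 1) → K) :
    innerPoly x ∈ originalPolys K e :=
  ⟨⟨monic_innerPoly x he, natDegree_innerPoly x he⟩, coeff_zero_innerPoly x he⟩

theorem outerPoly_coeff {g h : K[X]} (hg : g ∈ monicPolys K d) :
    outerPoly (Sum.elim (fun i : Fin d => g.coeff i) fun j : Fin (e - 1) => h.coeff (j + 1)) =
      g := by
  obtain ⟨hg, rfl⟩ := hg
  conv_rhs => rw [hg.as_sum, Finset.sum_range]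
  rfl

theorem innerPoly_coeff (he : 2 ≤ e) {g h : K[X]} (hh : h ∈ originalPolys K e) :
    innerPoly (Sum.elim (fun i : Fin d => g.coeff i) fun j : Fin (e - 1) => h.coeff (j + 1)) =
      h := by
  obtain ⟨⟨hh, hd⟩, h0⟩ := hh
  conv_rhs => rw [hh.as_sum, hd, show e = e - 1 + 1 by omega, Finset.sum_range_succ',
    Finset.sum_range, h0, C_0, zero_mul, add_zero, Nat.sub_add_cancel (by omega : 1 ≤ e)]
  rfl

/-- The coefficient vectors of all `(g, h)` with `(g ∘ h)(α_i) = β_i` for all `i`. -/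
def solutions (α β : Fin (d + e - 1) → K) : Set (Fin d ⊕ Fin (e - 1) → K) :=
  {x | ∀ i, ((outerPoly x).comp (innerPoly x)).eval (α i) = β i}

theorem fiber_eq_image (he : 2 ≤ e) (α β : Fin (d + e - 1) → K) :
    fiber K d e α β = (fun x => Sum.elim x (Sum.elim α β)) '' solutions α β := by
  ext y
  constructor
  · rintro ⟨⟨_, g, hg, h, hh, α', β', hgh, rfl⟩, hy, rfl⟩
    have hαβ : Sum.elim α' β' = Sum.elim α β := hy
    obtain rfl : α' = α := funext fun i => congrFun hαβ (Sum.inl i)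
    obtain rfl : β' = β := funext fun i => congrFun hαβ (Sum.inr i)
    refine ⟨_, fun i => ?_, rfl⟩
    rw [outerPoly_coeff hg, innerPoly_coeff he hh]
    exact hgh i
  · rintro ⟨x, hx, rfl⟩
    refine ⟨⟨_, outerPoly x, outerPoly_mem x, innerPoly x, innerPoly_mem he x, α, β, hx, rfl⟩,
      rfl, ?_⟩
    simp only [coordVec]
    congr 1
    ext (i | j)
    · exact coeff_outerPoly x i
    · exact coeff_innerPoly x he j

theorem interpolants_eq_image (he : 2 ≤ e) (α β : Fin (d + e - 1) → K) :
    interpolants K d e α β =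
      (fun x => (outerPoly x).comp (innerPoly x)) '' solutions α β := by
  ext f
  constructor
  · rintro ⟨⟨g, hg, h, hh, rfl⟩, hf⟩
    refine ⟨Sum.elim (fun i : Fin d => g.coeff i) fun j : Fin (e - 1) => h.coeff (j + 1),
      fun i => ?_, ?_⟩
    · rw [outerPoly_coeff hg, innerPoly_coeff he hh]
      exact hf i
    · simp only [outerPoly_coeff hg, innerPoly_coeff he hh]
  · rintro ⟨x, hx, rfl⟩
    exact ⟨⟨_, outerPoly_mem x, _, innerPoly_mem he x, rfl⟩, hx⟩

/-- The values of the generic composition at `α`, as polynomials in the coefficients. -/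
def genericValue (α : Fin (d + e - 1) → K) (i : Fin (d + e - 1)) :
    MvPolynomial (Fin d ⊕ Fin (e - 1)) K :=
  ((outerPoly MvPolynomial.X).comp (innerPoly MvPolynomial.X)).eval (MvPolynomial.C (α i))

theorem solutions_eq (α β : Fin (d + e - 1) → K) :
    solutions α β = {x | ∀ i, MvPolynomial.eval x (genericValue α i) = β i} := by
  ext x
  refine forall_congr' fun i => ?_
  rw [genericValue, map_eval_comp]
  simp

theorem isIntegral_adjoin_genericValue (F : Type*) [Field F] [Algebra F K] (hd : 2 ≤ d)
    (he : 2 ≤ e) {α : Fin (d + e - 1) → K} (hα : MvPolynomial.aeval α (R2 F d e) ≠ 0) :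
    Algebra.IsIntegral (Algebra.adjoin K (Set.range (genericValue (d := d) (e := e) α)))
      (MvPolynomial (Fin d ⊕ Fin (e - 1)) K) := by
  refine isIntegral_adjoin_of_valuationSubring _ fun V hK hV => ?_
  set L := FractionRing (MvPolynomial (Fin d ⊕ Fin (e - 1)) K)
  -- Since K lies in V, it embeds in the residue field, so determinants nonzero at α stay nonzero
  -- after reduction.
  let ι : K →+* V := (algebraMap K L).codRestrict V.toSubring hK
  let θ : MvPolynomial (Fin (d + e - 1)) F →+* V :=
    ι.comp (MvPolynomial.aeval α : MvPolynomial (Fin (d + e - 1)) F →ₐ[F] K).toRingHom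
  have hθX (i) : ((θ (MvPolynomial.X i) : V) : L) =
      algebraMap (MvPolynomial (Fin d ⊕ Fin (e - 1)) K) L (MvPolynomial.C (α i)) := by
    have h1 : θ (MvPolynomial.X i) = ι (α i) := by simp [θ]
    rw [h1]
    exact IsScalarTower.algebraMap_apply K (MvPolynomial (Fin d ⊕ Fin (e - 1)) K) L (α i)
  have hθ (P : Finpartition (Finset.univ : Finset (Fin (d + e - 1))))
      (hP : P.parts.card = d ∨ P.parts.card = d - 1) :
      IsLocalRing.residue V (θ (blockDet F P)) ≠ 0 := by
    have hdvd : blockDet F P ∣ R2 F d e := by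
      rcases hP with hP | hP
      · exact Dvd.dvd.mul_left (Finset.dvd_prod_of_mem _ (by simpa using hP)) _
      · exact Dvd.dvd.mul_right (Finset.dvd_prod_of_mem _ (by simpa using hP)) _
    have h0 : MvPolynomial.aeval α (blockDet F P) ≠ 0 := fun h0 =>
      hα (zero_dvd_iff.1 (h0 ▸ map_dvd (MvPolynomial.aeval α) hdvd))
    intro h
    refine h0 (((IsLocalRing.residue V).comp ι).injective ?_)
    rw [map_zero]
    exact h
  let x : Fin d ⊕ Fin (e - 1) → L := fun j =>
    algebraMap (MvPolynomial (Fin d ⊕ Fin (e - 1)) K) L (MvPolynomial.X j)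
  have hval (i) : ((outerPoly x).comp (innerPoly x)).eval ((θ (MvPolynomial.X i) : V) : L) ∈ V := by
    have := hV i
    rw [genericValue, map_eval_comp] at this
    rw [hθX]
    exact this
  have hin := coeff_mem_of_comp_eval_mem (fun P hP => hθ P (.inl hP)) (by omega)
    (monic_outerPoly x) (natDegree_outerPoly x) (monic_innerPoly x he) (natDegree_innerPoly x he)
    (coeff_zero_innerPoly x he) hval
  have hout := coeff_mem_of_comp_eval_mem_of_coeff_mem (by omega) (by omega)
    (fun P hP => hθ P (.inr hP)) (monic_outerPoly x) (natDegree_outerPoly x)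
    (monic_innerPoly x he) (natDegree_innerPoly x he) hval hin
  rintro (i | j)
  · have := hout i
    rwa [coeff_outerPoly] at this
  · have := hin (j + 1)
    rwa [coeff_innerPoly x he] at this

end

/-! ### Nonvanishing and density -/

theorem R2_ne_zero (F : Type*) [Field F] (d e : ℕ) : R2 F d e ≠ 0 :=
  mul_ne_zero (Finset.prod_ne_zero_iff.2 fun P _ => blockDet_ne_zero F P)
    (Finset.prod_ne_zero_iff.2 fun P _ => blockDet_ne_zero F P)

/-- A map whose image contains all points where a nonzero polynomial does not vanish is
dominant. -/
theorem isDominant_of_ne_zero {X σ K : Type*} [Field K] [Infinite K] {f : X → σ → K}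
    {r : MvPolynomial σ K} (hr : r ≠ 0)
    (h : ∀ y, MvPolynomial.eval y r ≠ 0 → y ∈ Set.range f) : IsDominant f := by
  refine Set.eq_univ_of_forall fun y p hp => ?_
  have hpr : p * r = 0 := MvPolynomial.funext fun z => by
    rw [map_mul, map_zero]
    by_cases hz : MvPolynomial.eval z r = 0
    · rw [hz, mul_zero]
    · have : MvPolynomial.eval z p = 0 := hp z (h z hz)
      rw [this, zero_mul]
  rw [(mul_eq_zero.1 hpr).resolve_right hr, map_zero]

end

end DecompInterp

theorem mainTheorem3 (F : Type*) [Field F] (K : Type*) [Field K] [Algebra F K] [IsAlgClosure F K]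
    (d e : ℕ) (hd : 2 ≤ d) (he : 2 ≤ e) (hchar : ¬ ringChar F ∣ d) :
    DecompInterp.IsDominant (DecompInterp.proj K d e) ∧
    (∀ α β : Fin (d + e - 1) → K, MvPolynomial.aeval α (DecompInterp.R2 F d e) ≠ 0 →
      DecompInterp.dimension (DecompInterp.fiber K d e α β) = 0) ∧
    DecompInterp.R2 F d e ≠ 0 ∧
    (∀ α β : Fin (d + e - 1) → K, MvPolynomial.aeval α (DecompInterp.R2 F d e) ≠ 0 →
      (DecompInterp.interpolants K d e α β).Finite ∧
      (DecompInterp.interpolants K d e α β).Nonempty) := by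
  have : IsAlgClosed K := IsAlgClosure.isAlgClosed F
  have hsol (α β : Fin (d + e - 1) → K)
      (hα : MvPolynomial.aeval α (DecompInterp.R2 F d e) ≠ 0) :
      (DecompInterp.solutions (d := d) (e := e) α β).Finite ∧
      (DecompInterp.solutions (d := d) (e := e) α β).Nonempty := by
    have := DecompInterp.isIntegral_adjoin_genericValue F hd he hα
    rw [DecompInterp.solutions_eq]
    refine ⟨DecompInterp.finite_setOf_eval_eq _ β, DecompInterp.nonempty_setOf_eval_eq ?_ _ β⟩
    simp
    omega
  have hfib (α β : Fin (d + e - 1) → K)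
      (hα : MvPolynomial.aeval α (DecompInterp.R2 F d e) ≠ 0) :
      (DecompInterp.fiber K d e α β).Finite ∧ (DecompInterp.fiber K d e α β).Nonempty := by
    rw [DecompInterp.fiber_eq_image he]
    exact ⟨(hsol α β hα).1.image _, (hsol α β hα).2.image _⟩
  refine ⟨?_, fun α β hα => DecompInterp.dimension_eq_zero_of_finite (hfib α β hα).1
    (hfib α β hα).2, DecompInterp.R2_ne_zero F d e, fun α β hα => ?_⟩
  · have : Infinite K := IsAlgClosed.instInfinite
    -- R2 is viewed over K as a polynomial in (α, β) that does not involve β.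
    refine DecompInterp.isDominant_of_ne_zero
      (r := MvPolynomial.rename Sum.inl
        (MvPolynomial.map (algebraMap F K) (DecompInterp.R2 F d e))) ?_ fun y hy => ?_
    · rw [Ne, map_eq_zero_iff _ (MvPolynomial.rename_injective _ Sum.inl_injective),
        map_eq_zero_iff _ (MvPolynomial.map_injective _ (algebraMap F K).injective)]
      exact DecompInterp.R2_ne_zero F d e
    · obtain ⟨_, z, hz, -⟩ := (hfib (y ∘ Sum.inl) (y ∘ Sum.inr) (by
        rw [MvPolynomial.eval_rename, MvPolynomial.eval_map] at hy
        exact hy)).2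
      refine ⟨z, ?_⟩
      rw [Set.mem_preimage, Set.mem_singleton_iff] at hz
      rw [hz, Sum.elim_comp_inl_inr]
  · rw [DecompInterp.interpolants_eq_image he]
    exact ⟨(hsol α β hα).1.image _, (hsol α β hα).2.image _⟩
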